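/- Throughout, $c_0$ is the Banach space of real sequences tending to $0$ with the supremum norm, and for $1\le p<\infty$, $\ell_p$ is the Banach space of real $p$-summable sequences with its usual norm. For a metric space $(M,d)$ and $K\in\mathbb R$, a map $f:M\to c_0$ is called a Lipschitz embedding with constant $K$ if $$d(x,y)\le \|f(x)-f(y)\|\le K\,d(x,y)\qquad\text{for all }x,y\in M.$$ (a) Let $X$ be a real Banach space and let $f:X\to c_0$ be a Lipschitz embedding with constant $\lambda_0$. Then for every $u\in X$ with $\|u\|=1$ and every infinite-dimensional linear subspace $Y$ of $X$, $$\inf_{y\in Y,\ \|y\|=1}\|u+y\|\le\lambda_0 .$$ (b) Let $1\le p<\infty$. Then there is a Lipschitz embedding of $\ell_p$ into $c_0$ with constant $2^{1/p}$, and this constant is best possible: if there is a Lipschitz embedding of $\ell_p$ into $c_0$ with constant $K$, then $K\ge 2^{1/p}$. -/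

import Mathlib

open scoped ENNReal ZeroAtInfty

/-- `f : M → N` is a Lipschitz embedding with constant `K`:
`d(x, y) ≤ d(f x, f y) ≤ K d(x, y)` for all `x, y`. -/
def IsLipschitzEmbeddingWith {M N : Type*} [MetricSpace M] [MetricSpace N]
    (K : ℝ) (f : M → N) : Prop :=
  ∀ x y : M, dist x y ≤ dist (f x) (f y) ∧ dist (f x) (f y) ≤ K * dist x y

/-- The Banach space `c₀` of real sequences tending to zero, with the supremum norm: functions on
the discrete space `ℕ` that vanish at infinity. -/
abbrev CZero : Type := C₀(ℕ, ℝ)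

/-- The Banach space `ℓ_p` of `p`-summable real sequences. -/
abbrev EllP (p : ℝ≥0∞) : Type := lp (fun _ : ℕ => ℝ) p

/-!
A Lipschitz embedding `f` of a Banach space into `c₀` forces `‖u + y‖ ≤ K`, up to arbitrarily small
errors, for some unit vector `y` of any infinite-dimensional subspace `Y`. If `‖u + y‖ ≥ m > K` for
all unit `y ∈ Y`, then `f (u + y)` and `f (-(u + y))` differ by more than `K + m` in some coordinate;
since all `u + y` lie at distance one from `u`, and `f u - f (-u)` tends to zero, only finitely many
coordinates can do this. Colour `y` by these coordinates and the sign of the difference. By an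
approximate Lusternik–Schnirelmann theorem (`exists_same_color_almost_antipodal`) two almost
antipodal points `y`, `y'` have the same colour, and comparing the pairs `u + y`, `-(u + y')` and
`u + y'`, `-(u + y)`, which are at distance about `2`, contradicts the Lipschitz bound.

In infinite dimensions this Lusternik–Schnirelmann theorem needs no topology. An ultrafilter on unit
vectors that is eventually annihilated by every functional yields, by iteration, sequences for which
the partial sums of a given linear combination have increasing norms. A suitable combination
`φ x = ∑ b i • x i` satisfies `φ x ≈ -φ (shift x)` (`exists_sum_add_shift_small`), and the iterated
ultrafilter assigns the same colour to the normalisations of `φ x` and `φ (shift x)`.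

For `ℓ_p` let `λ = 2 ^ (1 / p)`. The lower bound is the case where `u` is the first unit vector and
`Y` consists of the sequences vanishing at the first coordinate. For the embedding, take finite sets
`F n` of finitely supported vectors with `F 0 = {0}` and `d(x, F n) → 0`. Each pair `x ≠ y` has a
level `n` with `d(x, F n) + d(y, F n) ≥ c n ‖x - y‖` but
`d(x, F (n + 1)) + d(y, F (n + 1)) < c (n + 1) ‖x - y‖`, where `c n` is slightly less than `1 / λ`.
The second inequality says that `x` and `y` are close to finitely supported vectors, so that a
truncation `T` to finitely many coordinates satisfies `λ ‖T x - T y‖ > ‖x - y‖`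
(`exists_one_lt_mul_norm_le_truncate`); as the pairs of level `n` are bounded and uniformly
separated, finitely many `λ`-Lipschitz functions of `T` recover their distances. The first inequality
allows these functions to be clamped to `λ d(·, F n) + ε n` without losing this
(`exists_finite_separating`). The clamping makes the functions of all levels together tend to zero
at every point, so that they are the coordinates of a map into `c₀`.
-/

open Filter Topology

/-! ### Iterated ultrafilters on sequences -/

/-- The sequence `v, x 0, x 1, …`. -/
def seqCons {α : Type*} (v : α) (x : ℕ → α) : ℕ → α := fun n => Nat.casesOn n v x

/-- The `k`-fold product of an ultrafilter `U` with itself, as an ultrafilter on sequences that are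
padded with zeros from index `k` on: a property holds eventually iff it holds for `U`-almost all
`x 0`, then for `U`-almost all `x 1`, and so on up to `x (k - 1)`. -/
def iteratedUltrafilter {E : Type*} [Zero E] (U : Ultrafilter E) : ℕ → Ultrafilter (ℕ → E)
  | 0 => pure 0
  | k + 1 => U.bind fun v => (iteratedUltrafilter U k).map (seqCons v)

section Iterated

variable {E : Type*} [Zero E] (U : Ultrafilter E)

lemma eventually_iteratedUltrafilter_succ {k : ℕ} {P : (ℕ → E) → Prop} :
    (∀ᶠ x in (iteratedUltrafilter U (k + 1) : Filter (ℕ → E)), P x) ↔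
      ∀ᶠ v in (U : Filter E), ∀ᶠ x in (iteratedUltrafilter U k : Filter (ℕ → E)),
        P (seqCons v x) :=
  Iff.rfl

/-- The last coordinate of the iterated ultrafilter can be split off instead of the first one. -/
lemma eventually_iteratedUltrafilter_succ_last {k : ℕ} {P : (ℕ → E) → Prop} :
    (∀ᶠ x in (iteratedUltrafilter U (k + 1) : Filter (ℕ → E)), P x) ↔
      ∀ᶠ x in (iteratedUltrafilter U k : Filter (ℕ → E)), ∀ᶠ v in (U : Filter E),
        P (Function.update x k v) := by
  induction k generalizing P with
  | zero =>
    rw [eventually_iteratedUltrafilter_succ]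
    have h0 : ∀ v : E, seqCons v 0 = Function.update (0 : ℕ → E) 0 v := by
      intro v; funext n; cases n <;> simp [seqCons]
    change (∀ᶠ v in (U : Filter E), P (seqCons v 0)) ↔
      ∀ᶠ v in (U : Filter E), P (Function.update 0 0 v)
    simp only [h0]
  | succ k ih =>
    have h1 : ∀ (v w : E) (x : ℕ → E),
        seqCons v (Function.update x k w) = Function.update (seqCons v x) (k + 1) w := by
      intro v w x; funext n
      rcases n with _ | n
      · simp [seqCons]
      · by_cases h : n = k <;> simp [seqCons, h]
    rw [eventually_iteratedUltrafilter_succ, eventually_iteratedUltrafilter_succ]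
    simp only [ih, h1]

/-- A property of the first `k` coordinates holds for almost all longer sequences as soon as it
holds for almost all sequences of length `k`. -/
lemma eventually_iteratedUltrafilter_of_le {k m : ℕ} (hkm : k ≤ m) {P : (ℕ → E) → Prop}
    (hP : ∀ x x' : ℕ → E, (∀ i < k, x i = x' i) → P x → P x')
    (h : ∀ᶠ x in (iteratedUltrafilter U k : Filter (ℕ → E)), P x) :
    ∀ᶠ x in (iteratedUltrafilter U m : Filter (ℕ → E)), P x := by
  induction m, hkm using Nat.le_induction with
  | base => exact h
  | succ m hm ih =>
    rw [eventually_iteratedUltrafilter_succ_last]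
    filter_upwards [ih] with x hx
    refine Eventually.of_forall fun v => hP x _ (fun i hi => ?_) hx
    rw [Function.update_of_ne (by omega)]

lemma eventually_iteratedUltrafilter_shift {k : ℕ} {P : (ℕ → E) → Prop}
    (h : ∀ᶠ x in (iteratedUltrafilter U k : Filter (ℕ → E)), P x) (j : ℕ) :
    ∀ᶠ x in (iteratedUltrafilter U (k + j) : Filter (ℕ → E)), P (fun i => x (i + j)) := by
  induction j with
  | zero => exact h
  | succ j ih =>
    exact (eventually_iteratedUltrafilter_succ U (k := k + j)).2 (Eventually.of_forall fun v => ih)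

end Iterated

/-! ### Monotone linear combinations of unit vectors -/

section Normed

variable {E : Type*} [NormedAddCommGroup E] [NormedSpace ℝ E]

/-- An infinite-dimensional space carries an ultrafilter concentrated on unit vectors which are
annihilated by any prescribed functional. -/
lemma exists_ultrafilter_unit_ker (hE : ¬ FiniteDimensional ℝ E) :
    ∃ U : Ultrafilter E, (∀ᶠ v in (U : Filter E), ‖v‖ = 1) ∧
      ∀ g : StrongDual ℝ E, ∀ᶠ v in (U : Filter E), g v = 0 := by
  classical
  let A : Finset (StrongDual ℝ E) → Set E := fun s => {v | ‖v‖ = 1 ∧ ∀ g ∈ s, g v = 0}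
  have hne : ∀ s, (A s).Nonempty := by
    intro s
    let T : E →ₗ[ℝ] (s → ℝ) := LinearMap.pi fun g => (g.1 : E →ₗ[ℝ] ℝ)
    have hT : ¬ Function.Injective T := fun h => hE (FiniteDimensional.of_injective T h)
    rw [← LinearMap.ker_eq_bot, ← ne_eq, Submodule.ne_bot_iff] at hT
    obtain ⟨v, hv, hv0⟩ := hT
    refine ⟨‖v‖⁻¹ • v, by simp [norm_smul, hv0], fun g hg => ?_⟩
    have : g v = 0 := congrFun (LinearMap.mem_ker.1 hv) ⟨g, hg⟩
    simp [this]
  have hdir : Directed (· ≥ ·) fun s => 𝓟 (A s) := by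
    intro s t
    exact ⟨s ∪ t,
      principal_mono.2 fun v hv => ⟨hv.1, fun g hg => hv.2 g (Finset.mem_union_left _ hg)⟩,
      principal_mono.2 fun v hv => ⟨hv.1, fun g hg => hv.2 g (Finset.mem_union_right _ hg)⟩⟩
  have : (⨅ s, 𝓟 (A s)).NeBot := iInf_neBot_of_directed hdir fun s => principal_neBot_iff.2 (hne s)
  have hmem : ∀ s, A s ∈ (Ultrafilter.of (⨅ s, 𝓟 (A s)) : Filter E) := fun s =>
    Ultrafilter.of_le _ (mem_iInf_of_mem s (mem_principal_self _))
  refine ⟨Ultrafilter.of (⨅ s, 𝓟 (A s)), ?_, fun g => ?_⟩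
  · filter_upwards [hmem ∅] with v hv using hv.1
  · filter_upwards [hmem {g}] with v hv using hv.2 g (by simp)

variable {U : Ultrafilter E}

/-- Almost all sequences are monotone basic sequences, as far as the partial sums of one fixed
linear combination are concerned: a functional norming a partial sum annihilates the next vector. -/
lemma eventually_norm_sum_le_succ (hker : ∀ g : StrongDual ℝ E, ∀ᶠ v in (U : Filter E), g v = 0)
    (b : ℕ → ℝ) {n k : ℕ} (hn : n < k) :
    ∀ᶠ x in (iteratedUltrafilter U k : Filter (ℕ → E)),
      ‖∑ i ∈ Finset.range n, b i • x i‖ ≤ ‖∑ i ∈ Finset.range (n + 1), b i • x i‖ := by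
  refine eventually_iteratedUltrafilter_of_le U (k := n + 1) hn ?_ ?_
  · intro x x' h hx
    have h1 : ∀ j ≤ n + 1, ∑ i ∈ Finset.range j, b i • x i = ∑ i ∈ Finset.range j, b i • x' i :=
      fun j hj => Finset.sum_congr rfl fun i hi => by
        rw [h i (by have := Finset.mem_range.1 hi; omega)]
    rwa [h1 n (by omega), h1 (n + 1) le_rfl] at hx
  · rw [eventually_iteratedUltrafilter_succ_last]
    refine Eventually.of_forall fun x => ?_
    obtain ⟨g, hg1, hg⟩ := exists_dual_vector'' ℝ (∑ i ∈ Finset.range n, b i • x i)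
    filter_upwards [hker g] with v hv
    have h1 : ∑ i ∈ Finset.range n, b i • Function.update x n v i =
        ∑ i ∈ Finset.range n, b i • x i := Finset.sum_congr rfl fun i hi => by
      rw [Function.update_of_ne (Finset.mem_range.1 hi).ne]
    rw [Finset.sum_range_succ, h1, Function.update_self]
    calc ‖∑ i ∈ Finset.range n, b i • x i‖
        = g (∑ i ∈ Finset.range n, b i • x i + b n • v) := by simp [hv, hg]
      _ ≤ ‖g (∑ i ∈ Finset.range n, b i • x i + b n • v)‖ := Real.le_norm_self _
      _ ≤ 1 * _ := g.le_of_opNorm_le hg1 _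
      _ = _ := one_mul _

/-- Almost all sequences bound the coefficients of a fixed linear combination by its norm. -/
lemma eventually_abs_le_two_mul_norm_sum (hU : ∀ᶠ v in (U : Filter E), ‖v‖ = 1)
    (hker : ∀ g : StrongDual ℝ E, ∀ᶠ v in (U : Filter E), g v = 0)
    (b : ℕ → ℝ) {n k : ℕ} (hn : n < k) :
    ∀ᶠ x in (iteratedUltrafilter U k : Filter (ℕ → E)),
      |b n| ≤ 2 * ‖∑ i ∈ Finset.range k, b i • x i‖ := by
  have hall : ∀ᶠ x in (iteratedUltrafilter U k : Filter (ℕ → E)), ∀ j ∈ Finset.range k,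
      ‖∑ i ∈ Finset.range j, b i • x i‖ ≤ ‖∑ i ∈ Finset.range (j + 1), b i • x i‖ :=
    (Finset.eventually_all _).2 fun j hj =>
      eventually_norm_sum_le_succ hker b (Finset.mem_range.1 hj)
  have hunit : ∀ᶠ x in (iteratedUltrafilter U k : Filter (ℕ → E)), ‖x n‖ = 1 := by
    refine eventually_iteratedUltrafilter_of_le U (k := n + 1) hn
      (fun x x' h hx => by rwa [← h n (by omega)]) ?_
    rw [eventually_iteratedUltrafilter_succ_last]
    refine Eventually.of_forall fun x => ?_
    filter_upwards [hU] with v hv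
    simpa using hv
  filter_upwards [hall, hunit] with x hx h1
  have hmono : ∀ j, n + 1 ≤ j → j ≤ k →
      ‖∑ i ∈ Finset.range (n + 1), b i • x i‖ ≤ ‖∑ i ∈ Finset.range j, b i • x i‖ := by
    intro j hj
    induction j, hj using Nat.le_induction with
    | base => exact fun _ => le_rfl
    | succ j hj ih => exact fun hk => (ih (by omega)).trans (hx j (Finset.mem_range.2 (by omega)))
  have h2 := hmono k hn le_rfl
  have h3 := hx n (Finset.mem_range.2 hn)
  have h4 : ‖b n • x n‖ ≤ ‖∑ i ∈ Finset.range (n + 1), b i • x i‖ +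
      ‖∑ i ∈ Finset.range n, b i • x i‖ := by
    rw [Finset.sum_range_succ]
    simpa using norm_sub_le (∑ i ∈ Finset.range n, b i • x i + b n • x n)
      (∑ i ∈ Finset.range n, b i • x i)
  rw [norm_smul, h1, mul_one, Real.norm_eq_abs] at h4
  linarith

/-! ### Almost antipodal points of the same colour -/

lemma sum_alternating_add_shift (w : ℕ → E) (L : ℕ) :
    ∑ j ∈ Finset.range L, (-1 : ℝ) ^ j • w j + ∑ j ∈ Finset.range L, (-1 : ℝ) ^ j • w (j + 1) =
      w 0 - (-1 : ℝ) ^ L • w L := by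
  induction L with
  | zero => simp
  | succ L ih =>
    rw [Finset.sum_range_succ, Finset.sum_range_succ, pow_succ, add_add_add_comm, ih]
    module

/-- The coefficients of the iterated alternating sum `∑ j < L, ∑ i < L, (-1) ^ (i + j) x (i + j)`;
the middle one has absolute value `L`. -/
lemma exists_coeff_sum_sum_alternating (L : ℕ) (hL : 0 < L) :
    ∃ b : ℕ → ℝ, |b (L - 1)| = L ∧ ∀ x : ℕ → E,
      ∑ j ∈ Finset.range L, (-1 : ℝ) ^ j • ∑ i ∈ Finset.range L, (-1 : ℝ) ^ i • x (i + j) =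
        ∑ m ∈ Finset.range (2 * L), b m • x m := by
  refine ⟨fun m => ∑ j ∈ Finset.range L, if m ∈ Finset.Ico j (j + L) then (-1 : ℝ) ^ m else 0,
    ?_, fun x => ?_⟩
  · have : ∀ j ∈ Finset.range L, (if L - 1 ∈ Finset.Ico j (j + L) then (-1 : ℝ) ^ (L - 1) else 0) =
        (-1 : ℝ) ^ (L - 1) := fun j hj => if_pos (by
      have := Finset.mem_range.1 hj
      simp only [Finset.mem_Ico]; omega)
    simp only [Finset.sum_congr rfl this]
    simp [abs_mul]
  · simp only [Finset.sum_smul]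
    rw [Finset.sum_comm]
    refine Finset.sum_congr rfl fun j hj => ?_
    have hsub : Finset.Ico j (j + L) ⊆ Finset.range (2 * L) := fun m hm => by
      have := Finset.mem_range.1 hj
      have := Finset.mem_Ico.1 hm
      simp only [Finset.mem_range]; omega
    simp only [ite_smul, zero_smul]
    rw [← Finset.sum_filter, Finset.filter_mem_eq_inter, Finset.inter_eq_right.2 hsub,
      Finset.sum_Ico_eq_sum_range, Finset.smul_sum]
    simp only [Nat.add_sub_cancel_left]
    refine Finset.sum_congr rfl fun i _ => ?_
    rw [smul_smul, ← pow_add, add_comm j i]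

/-- Some fixed linear combination is almost reversed in sign when the sequence is shifted by one
step. Either the alternating sums of some length are large, and then they have this property since
shifting changes them, up to sign, by two unit vectors only; or all of them are bounded, and then
averages of consecutive shifts of alternating sums have it. -/
lemma exists_sum_add_shift_small (hU : ∀ᶠ v in (U : Filter E), ‖v‖ = 1)
    (hker : ∀ g : StrongDual ℝ E, ∀ᶠ v in (U : Filter E), g v = 0) {δ : ℝ} (hδ : 0 < δ) :
    ∃ (k : ℕ) (b : ℕ → ℝ),
      (∀ᶠ x in (iteratedUltrafilter U k : Filter (ℕ → E)),
        0 < ‖∑ i ∈ Finset.range k, b i • x i‖) ∧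
      ∀ᶠ x in (iteratedUltrafilter U (k + 1) : Filter (ℕ → E)),
        ‖∑ i ∈ Finset.range k, b i • x i + ∑ i ∈ Finset.range k, b i • x (i + 1)‖ ≤
          δ * ‖∑ i ∈ Finset.range k, b i • x i‖ := by
  have hdep : ∀ (b : ℕ → ℝ) (k : ℕ) (x x' : ℕ → E), (∀ i < k, x i = x' i) →
      ∑ i ∈ Finset.range k, b i • x i = ∑ i ∈ Finset.range k, b i • x' i :=
    fun b k x x' h => Finset.sum_congr rfl fun i hi => by rw [h i (Finset.mem_range.1 hi)]
  by_cases hsmall : ∃ L, ∀ᶠ x in (iteratedUltrafilter U L : Filter (ℕ → E)),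
      2 / δ ≤ ‖∑ i ∈ Finset.range L, (-1 : ℝ) ^ i • x i‖
  · obtain ⟨L, hL⟩ := hsmall
    refine ⟨L, fun i => (-1) ^ i, ?_, ?_⟩
    · filter_upwards [hL] with x hx using lt_of_lt_of_le (by positivity) hx
    · have hunit0 : ∀ᶠ x in (iteratedUltrafilter U (L + 1) : Filter (ℕ → E)), ‖x 0‖ = 1 := by
        rw [eventually_iteratedUltrafilter_succ]
        filter_upwards [hU] with v hv
        exact Eventually.of_forall fun x => hv
      have hunitL : ∀ᶠ x in (iteratedUltrafilter U (L + 1) : Filter (ℕ → E)), ‖x L‖ = 1 := by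
        rw [eventually_iteratedUltrafilter_succ_last]
        refine Eventually.of_forall fun x => ?_
        filter_upwards [hU] with v hv
        simpa using hv
      have hL' := eventually_iteratedUltrafilter_of_le U (Nat.le_succ L)
        (fun x x' h hx => by rwa [← hdep _ _ x x' h]) hL
      filter_upwards [hL', hunit0, hunitL] with x hx h0 h1
      rw [sum_alternating_add_shift]
      calc ‖x 0 - (-1 : ℝ) ^ L • x L‖ ≤ ‖x 0‖ + ‖(-1 : ℝ) ^ L • x L‖ := norm_sub_le _ _
        _ = δ * (2 / δ) := by
          rw [norm_smul, h0, h1]; simp; field_simp; norm_num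
        _ ≤ _ := by gcongr
  · push Not at hsmall
    obtain ⟨L, hL⟩ := exists_nat_gt (2 * (2 * (2 / δ)) / δ)
    have hLpos : 0 < L := by
      have : (0 : ℝ) < L := lt_of_le_of_lt (by positivity) hL
      exact_mod_cast this
    obtain ⟨b, hb, hsum⟩ := exists_coeff_sum_sum_alternating (E := E) L hLpos
    have hlow := eventually_abs_le_two_mul_norm_sum hU hker b (n := L - 1) (k := 2 * L) (by omega)
    rw [hb] at hlow
    refine ⟨2 * L, b, ?_, ?_⟩
    · filter_upwards [hlow] with x hx
      have : (0 : ℝ) < L := by exact_mod_cast hLpos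
      linarith
    · have h0 := eventually_iteratedUltrafilter_of_le U (show L ≤ 2 * L + 1 by omega)
        (fun x x' h hx => by rwa [← hdep _ _ x x' h]) (hsmall L)
      have h1 := eventually_iteratedUltrafilter_of_le U (show L + L ≤ 2 * L + 1 by omega)
        (fun x x' h hx => by
          rwa [← hdep _ _ (fun i => x (i + L)) (fun i => x' (i + L)) fun i hi => h _ (by omega)])
        (eventually_iteratedUltrafilter_shift U (hsmall L) L)
      have h2 := eventually_iteratedUltrafilter_of_le U (Nat.le_succ (2 * L))
        (fun x x' h hx => by rwa [← hdep _ _ x x' h]) hlow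
      filter_upwards [h0, h1, h2] with x h0 h1 h2
      have key := sum_alternating_add_shift
        (fun j => ∑ i ∈ Finset.range L, (-1 : ℝ) ^ i • x (i + j)) L
      have hs1 := hsum (fun i => x (i + 1))
      simp only [add_assoc] at hs1 key
      rw [hsum x, hs1] at key
      rw [key]
      have h3 : 2 * (2 * (2 / δ)) ≤ L * δ := by
        rw [div_lt_iff₀ hδ] at hL; exact hL.le
      calc _ ≤ ‖∑ i ∈ Finset.range L, (-1 : ℝ) ^ i • x (i + 0)‖ +
            ‖(-1 : ℝ) ^ L • ∑ i ∈ Finset.range L, (-1 : ℝ) ^ i • x (i + L)‖ := norm_sub_le _ _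
        _ ≤ 2 / δ + 2 / δ := by
          rw [norm_smul]
          simp only [norm_pow, norm_neg, norm_one, one_pow, one_mul, add_zero]
          exact add_le_add h0.le h1.le
        _ ≤ δ * (L / 2) := by linarith
        _ ≤ _ := by gcongr; linarith

lemma norm_normalize_add_normalize_le {v w : E} (hv : 0 < ‖v‖) (hw : 0 < ‖w‖) {δ : ℝ}
    (h : ‖v + w‖ ≤ δ * ‖v‖) : ‖‖v‖⁻¹ • v + ‖w‖⁻¹ • w‖ ≤ 2 * δ := by
  have h1 : ‖v‖⁻¹ • v + ‖w‖⁻¹ • w = ‖v‖⁻¹ • ((v + w) + (‖v‖ - ‖w‖) • ‖w‖⁻¹ • w) := by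
    rw [sub_smul, smul_inv_smul₀ hw.ne', smul_add, smul_add, smul_sub, inv_smul_smul₀ hv.ne']
    abel
  have h2 : |‖v‖ - ‖w‖| ≤ ‖v + w‖ := by
    simpa using abs_norm_sub_norm_le v (-w)
  rw [h1, norm_smul, norm_inv, norm_norm, inv_mul_le_iff₀ hv]
  calc _ ≤ ‖v + w‖ + ‖(‖v‖ - ‖w‖) • ‖w‖⁻¹ • w‖ := norm_add_le _ _
    _ = ‖v + w‖ + |‖v‖ - ‖w‖| := by
      rw [norm_smul, norm_smul, norm_inv, norm_norm, inv_mul_cancel₀ hw.ne', mul_one,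
        Real.norm_eq_abs]
    _ ≤ _ := by linarith

/-- An approximate Lusternik–Schnirelmann theorem for the unit sphere of an infinite-dimensional
normed space: every finite colouring has two almost antipodal points of the same colour. The two
points come from a sequence and its shift, to which the iterated ultrafilter gives one colour. -/
theorem exists_same_color_almost_antipodal (hE : ¬ FiniteDimensional ℝ E) {C : Type*} [Finite C]
    (col : E → C) {δ : ℝ} (hδ : 0 < δ) :
    ∃ y y' : E, ‖y‖ = 1 ∧ ‖y'‖ = 1 ∧ col y = col y' ∧ ‖y + y'‖ ≤ δ := by
  obtain ⟨U, hU, hker⟩ := exists_ultrafilter_unit_ker hE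
  obtain ⟨k, b, hpos, hsmall⟩ := exists_sum_add_shift_small hU hker (half_pos hδ)
  let φ : (ℕ → E) → E := fun x => ∑ i ∈ Finset.range k, b i • x i
  let ψ : (ℕ → E) → E := fun x => ‖φ x‖⁻¹ • φ x
  have hdep : ∀ x x' : ℕ → E, (∀ i < k, x i = x' i) → φ x = φ x' :=
    fun x x' h => Finset.sum_congr rfl fun i hi => by rw [h i (Finset.mem_range.1 hi)]
  obtain ⟨c, hc⟩ : ∃ c, ∀ᶠ x in (iteratedUltrafilter U k : Filter (ℕ → E)), col (ψ x) = c :=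
    Ultrafilter.eventually_exists_iff.1 (Eventually.of_forall fun x => ⟨_, rfl⟩)
  have hgood := hpos.and hc
  have h1 := eventually_iteratedUltrafilter_of_le U (Nat.le_succ k)
    (fun x x' h (hx : 0 < ‖φ x‖ ∧ col (ψ x) = c) =>
      (by simpa only [ψ, hdep x x' h] using hx : 0 < ‖φ x'‖ ∧ col (ψ x') = c)) hgood
  have h2 := eventually_iteratedUltrafilter_shift U hgood 1
  obtain ⟨x, ⟨hx1, hx2⟩, ⟨hx3, hx4⟩, hx5⟩ := (h1.and (h2.and hsmall)).exists
  refine ⟨ψ x, ψ fun i => x (i + 1), ?_, ?_, hx2.trans hx4.symm, ?_⟩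
  · simp only [ψ, norm_smul, norm_inv, norm_norm]
    exact inv_mul_cancel₀ hx1.ne'
  · simp only [ψ, norm_smul, norm_inv, norm_norm]
    exact inv_mul_cancel₀ hx3.ne'
  · have := norm_normalize_add_normalize_le hx1 hx3 hx5
    linarith

end Normed

/-! ### The lower bound for embeddings into `c₀` -/

lemma CZero.abs_sub_le_dist (g h : CZero) (n : ℕ) : |g n - h n| ≤ dist g h := by
  rw [← ZeroAtInftyContinuousMap.dist_toBCF_eq_dist, ← Real.dist_eq]
  exact BoundedContinuousFunction.dist_coe_le_dist (f := g.toBCF) (g := h.toBCF) n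

lemma CZero.dist_le {g h : CZero} {c : ℝ} (hc : 0 ≤ c) (H : ∀ n, |g n - h n| ≤ c) :
    dist g h ≤ c := by
  rw [← ZeroAtInftyContinuousMap.dist_toBCF_eq_dist]
  exact (BoundedContinuousFunction.dist_le hc).2 H

lemma CZero.tendsto_zero (g : CZero) : Tendsto g atTop (𝓝 0) := by
  have := g.zero_at_infty'
  rwa [cocompact_eq_cofinite, Nat.cofinite_eq_atTop] at this

/-- Points `y` of the unit sphere of `Y` are coloured according to those among finitely many
coordinates that separate `f (u + y)` from `f (-(u + y))` by more than `2 K`, together with the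
sign. If `y` and `y'` have the same colour and are almost antipodal, then `u + y` and `-(u + y')`
are at distance about `2`, as are `u + y'` and `-(u + y)`, and the Lipschitz bound is violated. -/
theorem sInf_norm_add_le_of_isLipschitzEmbeddingWith {X : Type*} [NormedAddCommGroup X]
    [NormedSpace ℝ X] {K : ℝ} {f : X → CZero} (hf : IsLipschitzEmbeddingWith K f) {u : X}
    (hu : ‖u‖ = 1) {Y : Submodule ℝ X} (hY : ¬ FiniteDimensional ℝ Y) :
    sInf ((fun y : X => ‖u + y‖) '' {y : X | y ∈ Y ∧ ‖y‖ = 1}) ≤ K := by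
  by_contra! hlt
  set m := sInf ((fun y : X => ‖u + y‖) '' {y : X | y ∈ Y ∧ ‖y‖ = 1}) with hm
  have hmle : ∀ y ∈ Y, ‖y‖ = 1 → m ≤ ‖u + y‖ := fun y hy h1 =>
    csInf_le ⟨0, by rintro _ ⟨z, -, rfl⟩; exact norm_nonneg _⟩ ⟨y, ⟨hy, h1⟩, rfl⟩
  have hK : 0 < K := by
    have := (hf u 0).1.trans (hf u 0).2
    rw [dist_zero_right, hu] at this
    linarith
  have hlip : ∀ x y n, f x n - f y n ≤ K * ‖x - y‖ := fun x y n =>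
    (le_abs_self _).trans ((CZero.abs_sub_le_dist _ _ n).trans
      ((hf x y).2.trans_eq (by rw [dist_eq_norm])))
  obtain ⟨N, hN⟩ : ∃ N, ∀ n ≥ N, |f u n - f (-u) n| < m - K := by
    have h := ((f u).tendsto_zero.sub (f (-u)).tendsto_zero).abs
    rw [sub_zero, abs_zero] at h
    exact eventually_atTop.1 (h.eventually (gt_mem_nhds (sub_pos.2 hlt)))
  let F : ℕ → Y → ℝ := fun n y => f (u + y) n - f (-(u + y)) n
  have hlarge : ∀ y : Y, ‖y‖ = 1 → ∃ n : Fin N, K + m < F n y ∨ F n y < -(K + m) := by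
    intro y hy
    have h1 : 2 * m ≤ dist (f (u + y)) (f (-(u + y))) := by
      refine le_trans ?_ (hf _ _).1
      rw [dist_eq_norm, sub_neg_eq_add, ← two_smul ℝ (u + (y : X)), norm_smul]
      have := hmle y y.2 hy
      norm_num
      exact this
    obtain ⟨n, hn⟩ : ∃ n, K + m < |F n y| := by
      by_contra! H
      have := CZero.dist_le (by linarith) H
      linarith
    -- Beyond `N` the two values differ by at most `K + K + (m - K) = K + m`.
    have hnN : n < N := by
      by_contra! H
      have h2 := hN n H
      have h3 := hlip (u + y) u n
      have h4 := hlip u (u + y) n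
      have h5 := hlip (-u) (-(u + y)) n
      have h6 := hlip (-(u + y)) (-u) n
      have hy' : ‖(y : X)‖ = 1 := hy
      have e3 : u + (y : X) - u = y := by abel
      have e4 : u - (u + (y : X)) = -y := by abel
      have e5 : -u - -(u + (y : X)) = y := by abel
      have e6 : -(u + (y : X)) - -u = -y := by abel
      rw [e3, hy'] at h3
      rw [e4, norm_neg, hy'] at h4
      rw [e5, hy'] at h5
      rw [e6, norm_neg, hy'] at h6
      rw [abs_lt] at h2
      have : |F n y| ≤ K + m := abs_le.2 ⟨by simp only [F]; linarith, by simp only [F]; linarith⟩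
      linarith
    exact ⟨⟨n, hnN⟩, (lt_abs.1 hn).imp id fun h => by linarith⟩
  have hδ : 0 < (m - K) / K := div_pos (sub_pos.2 hlt) hK
  obtain ⟨y, y', hy, -, hcol, hyy⟩ := exists_same_color_almost_antipodal hY
    (fun y => (fun n : Fin N => (K + m < F n y, F n y < -(K + m)))) hδ
  have hsum : ∀ n, f (u + y) n - f (-(u + y')) n ≤ K + m ∧
      f (-(u + y')) n - f (u + y) n ≤ K + m ∧
      f (u + y') n - f (-(u + y)) n ≤ K + m ∧ f (-(u + y)) n - f (u + y') n ≤ K + m := by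
    intro n
    have hnorm : ‖(u + u) + ((y : X) + y')‖ ≤ 2 + (m - K) / K := by
      have h1 : ‖u + u‖ ≤ 2 := (norm_add_le _ _).trans (by rw [hu]; norm_num)
      have h2 : ‖(y : X) + y'‖ ≤ (m - K) / K := hyy
      exact (norm_add_le _ _).trans (add_le_add h1 h2)
    have hKm : K * ‖(u + u) + ((y : X) + y')‖ ≤ K + m := by
      calc _ ≤ K * (2 + (m - K) / K) := by gcongr
        _ = _ := by field_simp; ring
    have h1 := hlip (u + y) (-(u + y')) n
    have h2 := hlip (-(u + y')) (u + y) n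
    have h3 := hlip (u + y') (-(u + y)) n
    have h4 := hlip (-(u + y)) (u + y') n
    have e1 : u + (y : X) - -(u + y') = (u + u) + (y + y') := by abel
    have e2 : -(u + (y' : X)) - (u + y) = -((u + u) + (y + y')) := by abel
    have e3 : u + (y' : X) - -(u + y) = (u + u) + (y + y') := by abel
    have e4 : -(u + (y : X)) - (u + y') = -((u + u) + (y + y')) := by abel
    rw [e1] at h1
    rw [e2, norm_neg] at h2
    rw [e3] at h3
    rw [e4, norm_neg] at h4
    exact ⟨by linarith, by linarith, by linarith, by linarith⟩
  obtain ⟨n, hn⟩ := hlarge y hy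
  have hc := congrFun hcol n
  simp only [Prod.mk.injEq] at hc
  obtain ⟨s1, s2, s3, s4⟩ := hsum n
  rcases hn with hn | hn
  · have hn' : K + m < F n y' := hc.1 ▸ hn
    simp only [F] at hn hn'
    linarith
  · have hn' : F n y' < -(K + m) := hc.2 ▸ hn
    simp only [F] at hn hn'
    linarith

/-! ### Gluing countably many Lipschitz functions into a map to `c₀` -/

lemma exists_isLipschitzEmbeddingWith_of_countable {M : Type*} [MetricSpace M] {ι : Type*}
    [Countable ι] {K : ℝ} (hK : 0 ≤ K) (F : ι → M → ℝ)
    (hlip : ∀ i x y, |F i x - F i y| ≤ K * dist x y)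
    (h0 : ∀ x, Tendsto (fun i => F i x) cofinite (𝓝 0))
    (hsep : ∀ x y, x ≠ y → ∃ i, dist x y ≤ |F i x - F i y|) :
    ∃ f : M → CZero, IsLipschitzEmbeddingWith K f := by
  obtain ⟨e, he⟩ := exists_injective_nat ι
  have hext : ∀ x, Tendsto (Function.extend e (fun i => F i x) 0) (cocompact ℕ) (𝓝 0) := by
    intro x
    rw [cocompact_eq_cofinite, Metric.tendsto_nhds]
    intro ε hε
    have hfin : {i | ¬ dist (F i x) 0 < ε}.Finite := Metric.tendsto_nhds.1 (h0 x) ε hε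
    refine (hfin.image e).subset fun n hn => ?_
    by_cases h : ∃ i, e i = n
    · obtain ⟨i, rfl⟩ := h
      refine ⟨i, ?_, rfl⟩
      have hn' : ¬ dist (Function.extend e (fun i => F i x) 0 (e i)) 0 < ε := hn
      rwa [he.extend_apply] at hn'
    · have hn' : ¬ dist (Function.extend e (fun i => F i x) 0 n) 0 < ε := hn
      rw [Function.extend_apply' _ _ _ h] at hn'
      simp [hε] at hn'
  let f : M → CZero := fun x =>
    ⟨⟨Function.extend e (fun i => F i x) 0, continuous_of_discreteTopology⟩, hext x⟩
  have hf : ∀ x n, f x n = Function.extend e (fun i => F i x) 0 n := fun _ _ => rfl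
  refine ⟨f, fun x y => ⟨?_, CZero.dist_le (by positivity) fun n => ?_⟩⟩
  · rcases eq_or_ne x y with rfl | hxy
    · simp
    · obtain ⟨i, hi⟩ := hsep x y hxy
      have := CZero.abs_sub_le_dist (f x) (f y) (e i)
      rw [hf, hf, he.extend_apply, he.extend_apply] at this
      exact hi.trans this
  · rw [hf, hf]
    by_cases h : ∃ i, e i = n
    · obtain ⟨i, rfl⟩ := h
      rw [he.extend_apply, he.extend_apply]
      exact hlip i x y
    · rw [Function.extend_apply' _ _ _ h, Function.extend_apply' _ _ _ h]
      simp only [Pi.zero_apply, sub_self, abs_zero]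
      positivity

/-! ### Pairs of points close to a finite set -/

lemma exists_pos_le_dist_of_finset {M : Type*} [MetricSpace M] [DecidableEq M] (F : Finset M) :
    ∃ σ > 0, ∀ a ∈ F, ∀ b ∈ F, a ≠ b → σ ≤ dist a b := by
  rcases F.offDiag.eq_empty_or_nonempty with h | h
  · refine ⟨1, one_pos, fun a ha b hb hab => ?_⟩
    have : (a, b) ∈ F.offDiag := Finset.mem_offDiag.2 ⟨ha, hb, hab⟩
    simp [h] at this
  · obtain ⟨q, hq, hmin⟩ := F.offDiag.exists_min_image (fun q => dist q.1 q.2) h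
    exact ⟨dist q.1 q.2, dist_pos.2 (Finset.mem_offDiag.1 hq).2.2, fun a ha b hb hab =>
      hmin (a, b) (Finset.mem_offDiag.2 ⟨ha, hb, hab⟩)⟩

/-- If the distances of `x` and `y` to a finite set add up to less than a fixed proportion
`c < 1` of `‖x - y‖`, then their nearest points in the set differ, and this confines the pair
`x, y` to a bounded region and bounds `‖x - y‖` from below. -/
lemma exists_bounds_of_infDist_add_infDist_lt {E : Type*} [NormedAddCommGroup E] (F : Finset E)
    (hF : F.Nonempty) {c : ℝ} (hc : c < 1) :
    ∃ σ > 0, ∃ R, ∀ x y : E, x ≠ y →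
      Metric.infDist x F + Metric.infDist y F < c * ‖x - y‖ →
      (∃ a ∈ F, ∃ b ∈ F, ‖x - a‖ + ‖y - b‖ ≤ c * ‖x - y‖) ∧
        σ ≤ ‖x - y‖ ∧ ‖x - y‖ ≤ R ∧ ‖x‖ ≤ R ∧ ‖y‖ ≤ R := by
  classical
  obtain ⟨σ, hσ, hsep⟩ := exists_pos_le_dist_of_finset F
  obtain ⟨a₀, -, hmax⟩ := F.exists_max_image (fun a => ‖a‖) hF
  set ρ := ‖a₀‖ with hρ
  have hc' : 0 < 1 - c := by linarith
  have hρ0 : 0 ≤ ρ := norm_nonneg _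
  refine ⟨σ / 2, half_pos hσ, ρ + 2 * ρ / (1 - c), fun x y hxy h => ?_⟩
  have hne : (F : Set E).Nonempty := hF
  obtain ⟨a, ha, hxa⟩ := F.finite_toSet.isCompact.exists_infDist_eq_dist hne x
  obtain ⟨b, hb, hyb⟩ := F.finite_toSet.isCompact.exists_infDist_eq_dist hne y
  rw [hxa, hyb, dist_eq_norm, dist_eq_norm] at h
  have hD : 0 < ‖x - y‖ := norm_pos_iff.2 (sub_ne_zero.2 hxy)
  have hab : a ≠ b := by
    rintro rfl
    have h1 : ‖x - y‖ ≤ ‖x - a‖ + ‖y - a‖ := by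
      rw [norm_sub_rev y a]; exact norm_sub_le_norm_sub_add_norm_sub x a y
    nlinarith
  have h1 := hsep a ha b hb hab
  rw [dist_eq_norm] at h1
  have h2 : ‖a - b‖ ≤ ‖x - a‖ + ‖x - y‖ + ‖y - b‖ := by
    have e : a - b = -(x - a) + (x - y) + (y - b) := by abel
    rw [e]
    exact (norm_add₃_le).trans (by rw [norm_neg])
  have h3 : ‖x - y‖ ≤ ‖x - a‖ + ‖a - b‖ + ‖y - b‖ := by
    have e : x - y = (x - a) + (a - b) + -(y - b) := by abel
    rw [e]
    exact (norm_add₃_le).trans (by rw [norm_neg])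
  have h4 : ‖a - b‖ ≤ ρ + ρ := (norm_sub_le _ _).trans (add_le_add (hmax a ha) (hmax b hb))
  have h5 : ‖x - y‖ ≤ 2 * ρ / (1 - c) := by
    rw [le_div_iff₀ hc']; linarith
  have hcD : c * ‖x - y‖ ≤ ‖x - y‖ := by nlinarith
  have h6 : ‖x‖ ≤ ‖a‖ + ‖x - a‖ := by
    simpa using norm_add_le a (x - a)
  have h7 : ‖y‖ ≤ ‖b‖ + ‖y - b‖ := by
    simpa using norm_add_le b (y - b)
  have h8 := hmax a ha
  have h9 := hmax b hb
  have h10 := norm_nonneg (x - a)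
  have h11 := norm_nonneg (y - b)
  refine ⟨⟨a, ha, b, hb, h.le⟩, by linarith, by linarith, by linarith, by linarith⟩

/-! ### Truncation in `ℓ_p` -/

section Truncation

variable {p : ℝ≥0∞}

/-- The coordinate projection of `ℓ_p` onto the sequences supported in `s`. -/
noncomputable def truncate (p : ℝ≥0∞) (s : Finset ℕ) (x : EllP p) : EllP p :=
  ∑ i ∈ s, lp.single p i (x i)

lemma truncate_apply (s : Finset ℕ) (x : EllP p) (j : ℕ) :
    truncate p s x j = if j ∈ s then x j else 0 := by
  simp only [truncate, lp.coeFn_sum, Finset.sum_apply, lp.coeFn_single, Finset.sum_pi_single]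

lemma truncate_sub (s : Finset ℕ) (x y : EllP p) :
    truncate p s (x - y) = truncate p s x - truncate p s y := by
  ext j
  simp only [truncate_apply, lp.coeFn_sub, Pi.sub_apply]
  split_ifs <;> simp

lemma truncate_eq_self_iff {s : Finset ℕ} {x : EllP p} :
    truncate p s x = x ↔ ∀ j ∉ s, x j = 0 := by
  constructor
  · intro h j hj
    rw [← h, truncate_apply, if_neg hj]
  · intro h
    ext j
    rw [truncate_apply]
    split_ifs with hj
    · rfl
    · exact (h j hj).symm

lemma norm_rpow_eq_truncate_add (hp : 0 < p.toReal) (s : Finset ℕ) (x : EllP p) :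
    ‖x‖ ^ p.toReal = ‖truncate p s x‖ ^ p.toReal + ‖x - truncate p s x‖ ^ p.toReal := by
  have h1 := lp.norm_sub_norm_compl_sub_single hp x s
  have h2 := lp.norm_sum_single hp x s
  simp only [truncate]
  linarith

variable [Fact (1 ≤ p)]

lemma norm_truncate_le (hp : 0 < p.toReal) (s : Finset ℕ) (x : EllP p) :
    ‖truncate p s x‖ ≤ ‖x‖ := by
  rw [← Real.rpow_le_rpow_iff (norm_nonneg _) (norm_nonneg _) hp,
    norm_rpow_eq_truncate_add hp s x]
  have : 0 ≤ ‖x - truncate p s x‖ ^ p.toReal := Real.rpow_nonneg (norm_nonneg _) _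
  linarith

lemma norm_sub_truncate_le (hp : 0 < p.toReal) (s : Finset ℕ) (x : EllP p) :
    ‖x - truncate p s x‖ ≤ ‖x‖ := by
  rw [← Real.rpow_le_rpow_iff (norm_nonneg _) (norm_nonneg _) hp,
    norm_rpow_eq_truncate_add hp s x]
  have : 0 ≤ ‖truncate p s x‖ ^ p.toReal := Real.rpow_nonneg (norm_nonneg _) _
  linarith

lemma continuous_sum_single (s : Finset ℕ) :
    Continuous fun a : ℕ → ℝ => (∑ i ∈ s, lp.single p i (a i) : EllP p) :=
  continuous_finsetSum _ fun i _ =>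
    (lp.isometry_single (E := fun _ : ℕ => ℝ) (p := p) i).continuous.comp (continuous_apply i)

/-- Truncations of a bounded set stay in a compact set. -/
lemma exists_isCompact_truncate_mem (s : Finset ℕ) (R : ℝ) :
    ∃ C : Set (EllP p), IsCompact C ∧ ∀ x, ‖x‖ ≤ R → truncate p s x ∈ C := by
  refine ⟨_, (isCompact_univ_pi fun _ : ℕ => isCompact_Icc (a := -R) (b := R)).image
    (continuous_sum_single (p := p) s), fun x hx => ⟨fun i => x i, fun i _ => ?_, rfl⟩⟩
  have h1 := lp.norm_apply_le_norm (zero_lt_one.trans_le (Fact.out : 1 ≤ p)).ne' x i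
  exact abs_le.1 (h1.trans hx)

/-- If `x` and `y` are close to vectors supported in `s`, relative to their distance, then the
truncation to `s` preserves their distance up to a factor better than `2 ^ (1 / p)`. -/
lemma exists_one_lt_mul_norm_le_truncate (hp : 0 < p.toReal) {c : ℝ} (hc0 : 0 ≤ c)
    (hc : c * 2 ^ (1 / p.toReal) < 1) :
    ∃ κ > 1, ∀ (s : Finset ℕ) (x y a b : EllP p), truncate p s a = a → truncate p s b = b →
      ‖x - a‖ + ‖y - b‖ ≤ c * ‖x - y‖ →
      κ * ‖x - y‖ ≤ 2 ^ (1 / p.toReal) * ‖truncate p s x - truncate p s y‖ := by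
  have h2 : ((2 : ℝ) ^ (1 / p.toReal)) ^ p.toReal = 2 := by
    rw [← Real.rpow_mul (by norm_num), one_div_mul_cancel hp.ne', Real.rpow_one]
  have hc2 : c ^ p.toReal * 2 < 1 := by
    have := Real.rpow_lt_rpow (by positivity) hc hp
    rwa [Real.mul_rpow hc0 (by positivity), h2, Real.one_rpow] at this
  have hbase : 1 < 2 * (1 - c ^ p.toReal) := by linarith
  refine ⟨(2 * (1 - c ^ p.toReal)) ^ (1 / p.toReal), Real.one_lt_rpow hbase (by positivity), ?_⟩
  intro s x y a b ha hb h
  have hQ : ‖(x - y) - truncate p s (x - y)‖ ≤ c * ‖x - y‖ := by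
    have e : (x - y) - truncate p s (x - y) =
        ((x - a) - truncate p s (x - a)) - ((y - b) - truncate p s (y - b)) := by
      rw [truncate_sub, truncate_sub, truncate_sub, ha, hb]; abel
    rw [e]
    exact (norm_sub_le _ _).trans ((add_le_add (norm_sub_truncate_le hp s _)
      (norm_sub_truncate_le hp s _)).trans h)
  have hQ' : ‖(x - y) - truncate p s (x - y)‖ ^ p.toReal ≤ c ^ p.toReal * ‖x - y‖ ^ p.toReal := by
    rw [← Real.mul_rpow hc0 (norm_nonneg _)]
    exact Real.rpow_le_rpow (norm_nonneg _) hQ hp.le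
  have hsplit := norm_rpow_eq_truncate_add hp s (x - y)
  rw [← truncate_sub, ← Real.rpow_le_rpow_iff (by positivity) (by positivity) hp,
    Real.mul_rpow (by positivity) (norm_nonneg _), Real.mul_rpow (by positivity) (norm_nonneg _),
    h2, ← Real.rpow_mul (by linarith), one_div_mul_cancel hp.ne', Real.rpow_one]
  linarith

/-! ### Finitely many functions separating the pairs close to a finite set -/

/-- The separating functions are `z ↦ A - λ ‖T z - w‖`, with `λ = 2 ^ (1 / p)` and `T` a
truncation, clamped to `[-m z, m z]`. For the pair `x, y` the ideal parameters are `w = T x` and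
`A = ‖x - y‖ - m y` (up to a small error); these range over a relatively compact set, so that a
finite net of parameters suffices. -/
lemma exists_finite_separating (hp : 0 < p.toReal) (F : Finset (EllP p)) (hF : F.Nonempty)
    (s : Finset ℕ) (hs : ∀ a ∈ F, truncate p s a = a) {c : ℝ} (hc0 : 0 ≤ c)
    (hc : c * 2 ^ (1 / p.toReal) < 1) (m : EllP p → ℝ) (hm0 : ∀ x, 0 ≤ m x)
    (hm : ∀ x y, |m x - m y| ≤ 2 ^ (1 / p.toReal) * dist x y) :
    ∃ G : Set (EllP p → ℝ), G.Finite ∧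
      (∀ g ∈ G, (∀ x y, |g x - g y| ≤ 2 ^ (1 / p.toReal) * dist x y) ∧ ∀ x, |g x| ≤ m x) ∧
      ∀ x y, x ≠ y → Metric.infDist x F + Metric.infDist y F < c * ‖x - y‖ →
        ‖x - y‖ ≤ m x + m y → ∃ g ∈ G, ‖x - y‖ ≤ |g x - g y| := by
  set K : ℝ := 2 ^ (1 / p.toReal) with hK
  have hK1 : 1 < K := Real.one_lt_rpow (by norm_num) (by positivity)
  obtain ⟨κ, hκ, htrunc⟩ := exists_one_lt_mul_norm_le_truncate hp hc0 hc
  obtain ⟨σ, hσ, R, hR⟩ := exists_bounds_of_infDist_add_infDist_lt F hF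
    (c := c) (by nlinarith)
  obtain ⟨C, hC, hCmem⟩ := exists_isCompact_truncate_mem (p := p) s R
  set τ : ℝ := (κ - 1) * σ / 2 with hτ
  have hτ0 : 0 < τ := half_pos (mul_pos (sub_pos.2 hκ) hσ)
  set B : ℝ := R + m 0 + K * R + τ with hB
  have hδ : 0 < τ / (1 + K) := by positivity
  obtain ⟨t, -, ht, htcov⟩ :=
    (hC.prod (isCompact_Icc (a := -B) (b := B))).finite_cover_balls hδ
  let g : EllP p × ℝ → EllP p → ℝ := fun q z =>
    max (-m z) (min (m z) (q.2 - K * ‖truncate p s z - q.1‖))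
  refine ⟨g '' t, ht.image g, ?_, ?_⟩
  · rintro _ ⟨q, -, rfl⟩
    refine ⟨fun x y => ?_, fun x => abs_le.2 ⟨le_max_left _ _, max_le ?_ (min_le_left _ _)⟩⟩
    · refine (abs_max_sub_max_le_max _ _ _ _).trans (max_le ?_ ?_)
      · rw [neg_sub_neg, abs_sub_comm]; exact hm x y
      · refine (abs_min_sub_min_le_max _ _ _ _).trans (max_le (hm x y) ?_)
        have e : q.2 - K * ‖truncate p s x - q.1‖ - (q.2 - K * ‖truncate p s y - q.1‖) =
            K * (‖truncate p s y - q.1‖ - ‖truncate p s x - q.1‖) := by ring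
        rw [e, abs_mul, abs_of_pos (by linarith : 0 < K), dist_comm, dist_eq_norm]
        gcongr
        refine (abs_norm_sub_norm_le _ _).trans ?_
        rw [sub_sub_sub_cancel_right, ← truncate_sub]
        exact norm_truncate_le hp s _
    · linarith [hm0 x]
  · intro x y hxy hlt hle
    obtain ⟨⟨a, ha, b, hb, hab⟩, hσD, hDR, hxR, hyR⟩ := hR x y hxy hlt
    have hT := htrunc s x y a b (hs a ha) (hs b hb) hab
    have hmy : m y ≤ m 0 + K * R := by
      have h1 := (le_abs_self _).trans (hm y 0)
      rw [dist_zero_right] at h1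
      have : K * ‖y‖ ≤ K * R := by gcongr
      linarith
    have hmem : (truncate p s x, ‖x - y‖ - m y + τ) ∈ C ×ˢ Set.Icc (-B) B := by
      refine ⟨hCmem x hxR, ?_, ?_⟩
      · have := norm_nonneg (x - y)
        simp only [hB]; linarith
      · have := hm0 y
        have := hm0 0
        have : 0 ≤ K * R := mul_nonneg (by linarith) ((norm_nonneg x).trans hxR)
        simp only [hB]; linarith
    obtain ⟨q, hq, hqd⟩ := Set.mem_iUnion₂.1 (htcov hmem)
    refine ⟨g q, ⟨q, hq, rfl⟩, ?_⟩
    rw [Metric.mem_ball, Prod.dist_eq, max_lt_iff] at hqd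
    obtain ⟨hq1, hq2⟩ := hqd
    simp only [dist_eq_norm] at hq1
    rw [Real.dist_eq, abs_lt] at hq2
    have hKq : K * ‖truncate p s x - q.1‖ + τ / (1 + K) ≤ τ := by
      have : K * ‖truncate p s x - q.1‖ ≤ K * (τ / (1 + K)) := by gcongr
      have e : K * (τ / (1 + K)) + τ / (1 + K) = τ := by field_simp; ring
      linarith
    have htri : ‖truncate p s x - truncate p s y‖ ≤
        ‖truncate p s x - q.1‖ + ‖truncate p s y - q.1‖ := by
      rw [norm_sub_rev (truncate p s y)]
      exact norm_sub_le_norm_sub_add_norm_sub _ _ _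
    have hKtri : K * ‖truncate p s x - truncate p s y‖ ≤
        K * ‖truncate p s x - q.1‖ + K * ‖truncate p s y - q.1‖ := by
      rw [← mul_add]; gcongr
    have hgap : ‖x - y‖ + 2 * τ ≤ K * ‖truncate p s x - truncate p s y‖ := by
      refine le_trans ?_ hT
      have : (κ - 1) * σ ≤ (κ - 1) * ‖x - y‖ := by
        have : 0 ≤ κ - 1 := by linarith
        gcongr
      simp only [hτ]; linarith
    have hgx : min (m x) (‖x - y‖ - m y) ≤ g q x :=
      le_max_of_le_right (min_le_min le_rfl (by linarith))
    have hgy : g q y ≤ max (-m y) (‖x - y‖ - m y + 2 * τ -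
        K * ‖truncate p s x - truncate p s y‖) :=
      max_le_max le_rfl ((min_le_right _ _).trans (by linarith))
    refine le_trans ?_ (le_abs_self _)
    -- Each of the four combinations of clamped and unclamped values has difference `≥ ‖x - y‖`.
    rcases min_choice (m x) (‖x - y‖ - m y) with h1 | h1 <;>
    rcases max_choice (-m y) (‖x - y‖ - m y + 2 * τ -
        K * ‖truncate p s x - truncate p s y‖) with h2 | h2 <;>
    rw [h1] at hgx <;> rw [h2] at hgy <;> linarith

/-! ### Exhausting `ℓ_p` by finite sets -/

lemma exists_dense_seq_truncate_eq_self (hp : p ≠ ∞) :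
    ∃ a : ℕ → EllP p, DenseRange a ∧ ∀ n, ∃ s, truncate p s (a n) = a n := by
  let S : Set (EllP p) := ⋃ s : Finset ℕ,
    Set.range fun a : ℕ → ℝ => (∑ i ∈ s, lp.single p i (a i) : EllP p)
  have hsep : TopologicalSpace.IsSeparable S :=
    .iUnion fun s => TopologicalSpace.isSeparable_range (continuous_sum_single s)
  have hSd : Dense S := fun x => mem_closure_of_tendsto (lp.hasSum_single hp x)
    (Eventually.of_forall fun s => Set.mem_iUnion.2 ⟨s, fun i => x i, rfl⟩)
  obtain ⟨t, htS, htc, hSt⟩ := hsep.exists_countable_dense_subset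
  have htd : Dense t := by
    rw [dense_iff_closure_eq] at hSd ⊢
    refine Set.eq_univ_of_univ_subset ?_
    rw [← hSd]
    exact closure_minimal hSt isClosed_closure
  obtain ⟨a, rfl⟩ := htc.exists_eq_range htd.nonempty
  refine ⟨a, htd, fun n => ?_⟩
  obtain ⟨s, v, hv⟩ := Set.mem_iUnion.1 (htS ⟨n, rfl⟩)
  refine ⟨s, truncate_eq_self_iff.2 fun j hj => ?_⟩
  rw [← hv]
  simp only [lp.coeFn_sum, Finset.sum_apply, lp.coeFn_single, Finset.sum_pi_single, if_neg hj]

lemma exists_finset_seq_infDist_tendsto_zero (hp : p ≠ ∞) :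
    ∃ (F : ℕ → Finset (EllP p)) (s : ℕ → Finset ℕ), F 0 = {0} ∧ (∀ n, (F n).Nonempty) ∧
      (∀ n, ∀ a ∈ F n, truncate p (s n) a = a) ∧
      ∀ x, Tendsto (fun n => Metric.infDist x (F n : Set (EllP p))) atTop (𝓝 0) := by
  classical
  obtain ⟨a, had, hsupp⟩ := exists_dense_seq_truncate_eq_self hp
  choose s hs using hsupp
  refine ⟨fun n => insert 0 ((Finset.range n).image a), fun n => (Finset.range n).biUnion s,
    by simp, fun n => Finset.insert_nonempty _ _, ?_, ?_⟩
  · intro n b hb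
    rw [truncate_eq_self_iff]
    intro j hj
    rcases Finset.mem_insert.1 hb with rfl | hb
    · simp
    · obtain ⟨i, hi, rfl⟩ := Finset.mem_image.1 hb
      exact truncate_eq_self_iff.1 (hs i) j
        fun hji => hj (Finset.mem_biUnion.2 ⟨i, hi, hji⟩)
  · intro x
    rw [Metric.tendsto_atTop]
    intro ε hε
    obtain ⟨i, hi⟩ := Metric.denseRange_iff.1 had x ε hε
    refine ⟨i + 1, fun n hn => ?_⟩
    rw [Real.dist_eq, sub_zero, abs_of_nonneg Metric.infDist_nonneg]
    refine lt_of_le_of_lt (Metric.infDist_le_dist_of_mem ?_) hi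
    simp only [Finset.coe_insert, Finset.coe_image]
    exact Or.inr ⟨i, by simpa using hn, rfl⟩

/-! ### The embedding of `ℓ_p` into `c₀` -/

theorem exists_isLipschitzEmbeddingWith_ellP (hp : p ≠ ∞) :
    ∃ f : EllP p → CZero, IsLipschitzEmbeddingWith ((2 : ℝ) ^ (1 / p.toReal)) f := by
  have hp0 : 0 < p.toReal :=
    ENNReal.toReal_pos (zero_lt_one.trans_le (Fact.out : 1 ≤ p)).ne' hp
  have hK1 : (1 : ℝ) < 2 ^ (1 / p.toReal) := Real.one_lt_rpow (by norm_num) (by positivity)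
  obtain ⟨F, s, hF0, hFne, hFs, hFlim⟩ := exists_finset_seq_infDist_tendsto_zero hp
  have hinv : (2 ^ (1 / p.toReal) : ℝ)⁻¹ < 1 := inv_lt_one_of_one_lt₀ hK1
  choose σ hσ R hR using fun n =>
    exists_bounds_of_infDist_add_infDist_lt (F n) (hFne n) hinv
  set K : ℝ := 2 ^ (1 / p.toReal) with hK
  have hKpos : 0 < K := by linarith
  -- The slack `ε n` at level `n` absorbs the loss from `c n < K⁻¹`, because the pairs handled at
  -- level `n` have distance at most `R (n + 1)`.
  let ε : ℕ → ℝ := fun n => 1 / ((n : ℝ) + 1)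
  let θ : ℕ → ℝ := fun n => min (1 / 2) (ε n / (|R (n + 1)| + 1))
  let c : ℕ → ℝ := fun n => K⁻¹ * (1 - θ n)
  let m : ℕ → EllP p → ℝ := fun n x => K * Metric.infDist x (F n) + ε n
  have hε : ∀ n, 0 < ε n := fun n => by positivity
  have hθ0 : ∀ n, 0 < θ n := fun n => lt_min (by norm_num) (div_pos (hε n) (by positivity))
  have hθ1 : ∀ n, θ n ≤ 1 / 2 := fun n => min_le_left _ _
  have hθR : ∀ n, θ n * R (n + 1) ≤ ε n := fun n => by
    have h1 : θ n * (|R (n + 1)| + 1) ≤ ε n := by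
      rw [← le_div_iff₀ (by positivity)]; exact min_le_right _ _
    have h2 := le_abs_self (R (n + 1))
    have h3 := hθ0 n
    nlinarith
  have hcK : ∀ n, c n < K⁻¹ := fun n => by
    have := hθ0 n
    have h2 : 0 < K⁻¹ := inv_pos.2 hKpos
    simp only [c]; nlinarith
  have hc_low : ∀ n, K⁻¹ / 2 ≤ c n := fun n => by
    have := hθ1 n
    have h2 : 0 < K⁻¹ := inv_pos.2 hKpos
    simp only [c]; nlinarith
  have hc0 : ∀ n, 0 ≤ c n := fun n => le_trans (by positivity) (hc_low n)
  have hcK1 : ∀ n, c n * K < 1 := fun n => by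
    have := mul_lt_mul_of_pos_right (hcK n) hKpos
    rwa [inv_mul_cancel₀ hKpos.ne'] at this
  have hm0 : ∀ n x, 0 ≤ m n x := fun n x =>
    add_nonneg (mul_nonneg hKpos.le Metric.infDist_nonneg) (hε n).le
  have hmlip : ∀ n x y, |m n x - m n y| ≤ K * dist x y := fun n x y => by
    have e : m n x - m n y = K * (Metric.infDist x (F n) - Metric.infDist y (F n)) := by
      simp only [m]; ring
    rw [e, abs_mul, abs_of_pos hKpos]
    gcongr
    have := (Metric.lipschitz_infDist_pt (F n : Set (EllP p))).dist_le_mul x y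
    rwa [NNReal.coe_one, one_mul, Real.dist_eq] at this
  have hmlim : ∀ x, Tendsto (fun n => m n x) atTop (𝓝 0) := fun x => by
    have := ((hFlim x).const_mul K).add (tendsto_one_div_add_atTop_nhds_zero_nat (𝕜 := ℝ))
    simpa [m, ε] using this
  choose G hGfin hG hGsep using fun n => exists_finite_separating hp0 (F (n + 1)) (hFne _)
    (s (n + 1)) (hFs _) (hc0 (n + 1)) (hcK1 (n + 1)) (m n) (hm0 n) (hmlip n)
  have hfin : ∀ n, Finite (G n) := hGfin
  refine exists_isLipschitzEmbeddingWith_of_countable (ι := Σ n, G n) hKpos.le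
    (fun i => i.2.1) (fun i => ((hG i.1) i.2.1 i.2.2).1) ?_ ?_
  · intro x
    rw [Metric.tendsto_nhds]
    intro η hη
    obtain ⟨n₀, hn₀⟩ := eventually_atTop.1 ((hmlim x).eventually (gt_mem_nhds hη))
    have hbig : (⋃ n ∈ Finset.range n₀, Set.range (Sigma.mk (β := fun n => G n) n)).Finite :=
      (Finset.range n₀).finite_toSet.biUnion fun n _ => Set.finite_range _
    refine hbig.subset fun i hi => ?_
    have hi' : ¬ dist (i.2.1 x) 0 < η := hi
    have hlt : i.1 < n₀ := by
      by_contra! h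
      refine hi' ?_
      rw [Real.dist_eq, sub_zero]
      exact lt_of_le_of_lt (((hG i.1) i.2.1 i.2.2).2 x) (hn₀ _ h)
    exact Set.mem_iUnion₂.2 ⟨i.1, Finset.mem_range.2 hlt, i.2, rfl⟩
  · intro x y hxy
    have hD : 0 < ‖x - y‖ := norm_pos_iff.2 (sub_ne_zero.2 hxy)
    -- The level of the pair is the `n` just before these sums first become small.
    have hex : ∃ n, Metric.infDist x (F n) + Metric.infDist y (F n) < c n * ‖x - y‖ := by
      have hlim := (hFlim x).add (hFlim y)
      rw [add_zero] at hlim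
      obtain ⟨n, hn⟩ := (hlim.eventually (gt_mem_nhds
        (show 0 < K⁻¹ / 2 * ‖x - y‖ by positivity))).exists
      exact ⟨n, hn.trans_le (by gcongr; exact hc_low n)⟩
    classical
    obtain ⟨n, hn, hmin⟩ : ∃ n, (Metric.infDist x (F (n + 1)) + Metric.infDist y (F (n + 1)) <
        c (n + 1) * ‖x - y‖) ∧
        c n * ‖x - y‖ ≤ Metric.infDist x (F n) + Metric.infDist y (F n) := by
      have hspec := Nat.find_spec hex
      rcases hfind : Nat.find hex with _ | n
      · rw [hfind, hF0] at hspec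
        simp only [Finset.coe_singleton, Metric.infDist_singleton, dist_zero_right] at hspec
        have h1 := norm_sub_le x y
        have h2 := hcK 0
        nlinarith
      · rw [hfind] at hspec
        exact ⟨n, hspec, not_lt.1 (Nat.find_min hex (by omega))⟩
    have hDR : ‖x - y‖ ≤ R (n + 1) := by
      refine (hR (n + 1) x y hxy (hn.trans_le ?_)).2.2.1
      gcongr
      exact (hcK _).le
    have hsum : ‖x - y‖ ≤ m n x + m n y := by
      have h1 : K * (c n * ‖x - y‖) ≤
          K * (Metric.infDist x (F n) + Metric.infDist y (F n)) := by gcongr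
      have h2 : K * (c n * ‖x - y‖) = ‖x - y‖ - θ n * ‖x - y‖ := by
        simp only [c]; field_simp
      have h3 : θ n * ‖x - y‖ ≤ ε n :=
        (mul_le_mul_of_nonneg_left hDR (hθ0 n).le).trans (hθR n)
      have h4 := hε n
      simp only [m]
      linarith
    obtain ⟨g, hg, hgxy⟩ := hGsep n x y hxy hn hsum
    exact ⟨⟨n, g, hg⟩, by rw [dist_eq_norm]; exact hgxy⟩

end Truncation

/-! ### Optimality of the constant for `ℓ_p` -/

lemma norm_single_add_eq {p : ℝ≥0∞} [Fact (1 ≤ p)] (hp : p ≠ ∞) {y : EllP p} (hy0 : y 0 = 0)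
    (hy : ‖y‖ = 1) :
    ‖lp.single p 0 (1 : ℝ) + y‖ = 2 ^ (1 / p.toReal) := by
  have hp0' : 0 < p := zero_lt_one.trans_le (Fact.out : 1 ≤ p)
  have hp0 : 0 < p.toReal := ENNReal.toReal_pos hp0'.ne' hp
  have h := norm_rpow_eq_truncate_add hp0 {0} (lp.single p 0 (1 : ℝ) + y)
  have ht : truncate p {0} (lp.single p 0 (1 : ℝ) + y) = lp.single p 0 (1 : ℝ) := by
    simp [truncate, hy0]
  rw [ht, add_sub_cancel_left, hy, lp.norm_single hp0', norm_one, Real.one_rpow] at h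
  rw [← Real.rpow_left_inj (norm_nonneg _) (by positivity) hp0.ne', h,
    ← Real.rpow_mul (by norm_num), one_div_mul_cancel hp0.ne', Real.rpow_one]
  norm_num

lemma not_finiteDimensional_ker_eval_zero {p : ℝ≥0∞} :
    ¬ FiniteDimensional ℝ (LinearMap.ker (lp.evalₗ (𝕜 := ℝ) (fun _ : ℕ => ℝ) p 0)) := by
  intro hfin
  let v : ℕ → LinearMap.ker (lp.evalₗ (𝕜 := ℝ) (fun _ : ℕ => ℝ) p 0) := fun i =>
    ⟨lp.single p (i + 1) (1 : ℝ), by simp [LinearMap.mem_ker]⟩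
  have hv : LinearIndependent ℝ v := by
    rw [linearIndependent_iff']
    intro s g hg i hi
    have h1 := congrArg (lp.evalₗ (𝕜 := ℝ) (fun _ : ℕ => ℝ) p (i + 1) ∘ₗ Submodule.subtype _) hg
    simp only [map_sum, map_smul] at h1
    simpa [v, Pi.single_apply, hi] using h1
  exact not_finite_iff_infinite.2 (inferInstance : Infinite ℕ) hv.finite

theorem two_rpow_le_of_isLipschitzEmbeddingWith {p : ℝ≥0∞} [Fact (1 ≤ p)] (hp : p ≠ ∞) {K : ℝ}
    {f : EllP p → CZero} (hf : IsLipschitzEmbeddingWith K f) : (2 : ℝ) ^ (1 / p.toReal) ≤ K := by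
  have hp0 : 0 < p := zero_lt_one.trans_le (Fact.out : 1 ≤ p)
  have hu : ‖(lp.single p 0 (1 : ℝ) : EllP p)‖ = 1 := by
    rw [lp.norm_single hp0, norm_one]
  refine le_trans ?_ (sInf_norm_add_le_of_isLipschitzEmbeddingWith hf hu
    not_finiteDimensional_ker_eval_zero)
  refine le_csInf ?_ ?_
  · refine ⟨_, lp.single p 1 (1 : ℝ), ⟨?_, ?_⟩, rfl⟩
    · simp [LinearMap.mem_ker]
    · rw [lp.norm_single hp0, norm_one]
  · rintro _ ⟨y, ⟨hy, hy1⟩, rfl⟩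
    exact (norm_single_add_eq hp (LinearMap.mem_ker.1 hy) hy1).ge

theorem theorem3p2 :
    -- the lower bound for a general Banach space
    (∀ (X : Type*) [NormedAddCommGroup X] [NormedSpace ℝ X] [CompleteSpace X]
        (K : ℝ) (f : X → CZero), IsLipschitzEmbeddingWith K f →
        ∀ u : X, ‖u‖ = 1 → ∀ Y : Submodule ℝ X, ¬ FiniteDimensional ℝ Y →
          sInf ((fun y : X => ‖u + y‖) '' {y : X | y ∈ Y ∧ ‖y‖ = 1}) ≤ K) ∧
    -- the best constant for `ℓ_p`
    (∀ (p : ℝ≥0∞) [Fact (1 ≤ p)], p ≠ ∞ →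
        IsLeast {K : ℝ | ∃ f : EllP p → CZero, IsLipschitzEmbeddingWith K f}
          ((2 : ℝ) ^ (1 / p.toReal))) :=
  ⟨fun _ _ _ _ _ _ hf _ hu _ hY => sInf_norm_add_le_of_isLipschitzEmbeddingWith hf hu hY,
    fun _ _ hp => ⟨exists_isLipschitzEmbeddingWith_ellP hp,
      fun _ ⟨_, hf⟩ => two_rpow_le_of_isLipschitzEmbeddingWith hp hf⟩⟩
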